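/- Let $(M, g_M)$ be an oriented $\mathscr{C}^1$ Riemannian manifold that is compact, Hausdorff, second-countable, and without boundary, and let $\sigma$ denote the Borel measure on $M$ induced by the Riemannian volume form of $M$. Let $m$ denote Lebesgue measure on $\mathbb{R}^\ell$. Let $h : M \to \mathbb{R}^\ell$ be a $\mathscr{C}^1$ map such that $h^{-1}(\mathbf{0}) \neq \varnothing$ and every element $z$ of $h^{-1}(\mathbf{0})$ is a regular point of $h$ (that is, the differential $D_z h : T_z M \to T_{h(z)}\mathbb{R}^\ell$ is surjective). Then there exist an open set $V \subseteq \mathbb{R}^\ell$ with $\mathbf{0} \in V$ and a real constant $C > 0$ (depending only on $M$, $g_M$, $h$) such that for every Borel set $E \subseteq \mathbb{R}^\ell$ with $E \subseteq V$, \[ \sigma\big(h^{-1}(E)\big) \le C\, m(E) \qquad\text{and}\qquad m(E) \le C\, \sigma\big(h^{-1}(E)\big). \] -/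

import Mathlib

open MeasureTheory Set Filter Topology Bundle
open scoped Manifold ENNReal NNReal

noncomputable section

/-- `x` is a regular point of `f`: `f` is continuously differentiable on a neighbourhood of `x`, and
its differential `T_x M → T_{f x} N` is surjective. -/
def IsRegularPoint {E : Type*} [NormedAddCommGroup E] [NormedSpace ℝ E]
    {H : Type*} [TopologicalSpace H] (I : ModelWithCorners ℝ E H)
    {E' : Type*} [NormedAddCommGroup E'] [NormedSpace ℝ E']
    {H' : Type*} [TopologicalSpace H'] (I' : ModelWithCorners ℝ E' H')
    {M : Type*} [TopologicalSpace M] [ChartedSpace H M]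
    {N : Type*} [TopologicalSpace N] [ChartedSpace H' N] (f : M → N) (x : M) : Prop :=
  ContMDiffAt I I' 1 f x ∧ Function.Surjective (mfderiv I I' f x)

/-- An orientation of a `k`-dimensional `C^1` manifold (without boundary): an orientation of each
tangent space which, read in the local trivializations of the tangent bundle given by the charts, is
locally constant. -/
structure ManifoldOrientation (k : ℕ) (M : Type*) [TopologicalSpace M]
    [ChartedSpace (EuclideanSpace ℝ (Fin k)) M] [IsManifold (𝓡 k) 1 M] where
  /-- The orientation of the tangent space at a point. -/
  orientationAt : ∀ x : M, Orientation ℝ (TangentSpace (𝓡 k) x) (Fin k)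
  locallyConstant : ∀ x₀ : M, ∃ o₀ : Orientation ℝ (EuclideanSpace ℝ (Fin k)) (Fin k),
    ∀ᶠ x in 𝓝 x₀, ∀ hx : x ∈ (trivializationAt (EuclideanSpace ℝ (Fin k))
        (fun y : M => TangentSpace (𝓡 k) y) x₀).baseSet,
      Orientation.map (Fin k)
        ((trivializationAt (EuclideanSpace ℝ (Fin k))
          (fun y : M => TangentSpace (𝓡 k) y) x₀).continuousLinearEquivAt ℝ x hx).toLinearEquiv
        (orientationAt x) = o₀

section RiemannianVolume

variable {k : ℕ} {M : Type*} [TopologicalSpace M]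
  [ChartedSpace (EuclideanSpace ℝ (Fin k)) M] [IsManifold (𝓡 k) 1 M]

instance factFinrankTangentSpace (x : M) :
    Fact (Module.finrank ℝ (TangentSpace (𝓡 k) x) = k) :=
  ⟨finrank_euclideanSpace_fin (𝕜 := ℝ) (n := k)⟩

/-- The coordinate frame `∂/∂y₁, …, ∂/∂yₖ` of the chart `φ`, as tangent vectors to `M` at the point
`φ⁻¹ y`, where `y` lies in the target of `φ`. -/
def coordFrame (φ : OpenPartialHomeomorph M (EuclideanSpace ℝ (Fin k)))
    (y : EuclideanSpace ℝ (Fin k)) (i : Fin k) : TangentSpace (𝓡 k) (φ.symm y) :=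
  mfderiv (𝓡 k) (𝓡 k) φ.symm y (EuclideanSpace.single i (1 : ℝ) : EuclideanSpace ℝ (Fin k))

variable [RiemannianBundle (fun x : M => TangentSpace (𝓡 k) x)]

/-- The Riemannian volume form: at each point `x`, the alternating form on the inner product space
`T_x M` which takes the value `1` on the positively oriented orthonormal bases. -/
def riemannianVolumeForm (o : ManifoldOrientation k M) (x : M) :
    (TangentSpace (𝓡 k) x) [⋀^Fin k]→ₗ[ℝ] ℝ :=
  (o.orientationAt x).volumeForm

variable [MeasurableSpace M]

/-- The measure induced by the Riemannian volume form `ω` on the domain of a chart `φ`: a Borel subset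
`A` of the domain has measure `∫_{φ(A)} |ω(∂/∂y₁, …, ∂/∂yₖ)| dy`. In a positively oriented chart
the absolute value is superfluous. The complement of the domain has measure zero. -/
def chartRiemannianVolume (o : ManifoldOrientation k M)
    (φ : OpenPartialHomeomorph M (EuclideanSpace ℝ (Fin k))) : Measure M :=
  ((volume.restrict φ.target).withDensity
    (fun y => ‖riemannianVolumeForm o (φ.symm y) (coordFrame φ y)‖ₑ)).map φ.symm

/-- The measure induced by the Riemannian volume form. The measures induced on the domains of the
charts agree on overlaps, so that their supremum is the one Borel measure on the (second-countable)
manifold which restricts to each of them. -/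
def riemannianVolume (o : ManifoldOrientation k M) : Measure M :=
  ⨆ φ ∈ atlas (EuclideanSpace ℝ (Fin k)) M, chartRiemannianVolume o φ

end RiemannianVolume

end

/-! Near a regular zero `z`, the implicit function theorem completes `h` to local coordinates in
which it is a linear projection. By Fubini, the preimage of `T` in a small box has measure (fibre
volume) times the measure of `T`. Lebesgue measure in a chart and Riemannian volume differ by
bounded factors, so the estimate passes to `M`.

The zero set is compact, so finitely many such neighbourhoods cover it. The complement of their
union has compact image missing 0, so for `E` near 0 all of `h ⁻¹' E` lies in the union. Summing
over the cover gives the upper bound; one neighbourhood suffices for the lower bound. -/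

/-- A strictly differentiable map with surjective derivative locally transports Haar measure to
Haar measure up to multiplicative constants. -/
theorem HasStrictFDerivAt.exists_open_addHaar_preimage_le
    {E F : Type*} [NormedAddCommGroup E] [NormedSpace ℝ E] [FiniteDimensional ℝ E]
    [MeasurableSpace E] [BorelSpace E] (μ : Measure E) [μ.IsAddHaarMeasure]
    [NormedAddCommGroup F] [NormedSpace ℝ F] [FiniteDimensional ℝ F]
    [MeasurableSpace F] [BorelSpace F] (ν : Measure F) [ν.IsAddHaarMeasure]
    {f : E → F} {f' : E →L[ℝ] F} {a : E} (hf : HasStrictFDerivAt f f' a)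
    (hf' : Function.Surjective f') {N : Set E} (hN : N ∈ 𝓝 a) :
    ∃ W ⊆ N, IsOpen W ∧ a ∈ W ∧ ∃ V : Set F, IsOpen V ∧ f a ∈ V ∧ ∃ C : ℝ≥0, ∀ T : Set F,
      μ (W ∩ f ⁻¹' T) ≤ C * ν T ∧ (T ⊆ V → ν T ≤ C * μ (W ∩ f ⁻¹' T)) := by
  have hrange : f'.range = ⊤ := LinearMap.range_eq_top.2 hf'
  have hcompl := f'.ker_closedComplemented_of_finiteDimensional_range
  let φ := HasStrictFDerivAt.implicitFunctionDataOfComplemented f f' hf hrange hcompl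
  let Ψ := φ.toOpenPartialHomeomorph
  let e : E ≃L[ℝ] F × f'.ker := φ.leftDeriv.equivProdOfSurjectiveOfIsCompl φ.rightDeriv
    φ.range_leftDeriv φ.range_rightDeriv φ.isCompl_ker
  have hΨ : HasStrictFDerivAt Ψ (e : E →L[ℝ] F × f'.ker) a := φ.hasStrictFDerivAt
  have hΨf : ∀ x, (Ψ x).1 = f x := fun x => rfl
  -- Undoing the derivative `e` leaves a map with derivative the identity, which distorts `μ` near
  -- `a` by a factor between 1/2 and 2. The estimates used hold for arbitrary sets, so `T` need not
  -- be measurable.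
  have hg : HasStrictFDerivAt (e.symm ∘ Ψ) (ContinuousLinearMap.id ℝ E) a := by
    have := e.symm.hasStrictFDerivAt.comp a hΨ
    rwa [ContinuousLinearEquiv.coe_symm_comp_coe] at this
  obtain ⟨δ, hδ₁, hδ₂, hδ⟩ := ((addHaar_image_le_mul_of_det_lt μ
    (ContinuousLinearMap.id ℝ E) (m := 2) (by simp [ContinuousLinearMap.det])).and
    ((mul_le_addHaar_image_of_lt_det μ (ContinuousLinearMap.id ℝ E) (m := 2⁻¹)
      (by simp [ContinuousLinearMap.det])).and self_mem_nhdsWithin)).exists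
  obtain ⟨A, hA, happ⟩ := hg.approximates_deriv_on_nhds (c := δ) (Or.inr hδ)
  have ha : a ∈ Ψ.source := φ.pt_mem_toOpenPartialHomeomorph_source
  have hnhds : Ψ.target ∩ Ψ.symm ⁻¹' (N ∩ A) ∈ 𝓝 (Ψ a) := by
    refine inter_mem (Ψ.open_target.mem_nhds (Ψ.map_source ha)) ?_
    exact (Ψ.tendsto_symm ha) (inter_mem hN hA)
  obtain ⟨B, B', hB, haB, hB', haB', hBB⟩ := mem_nhds_prod_iff'.1 hnhds
  let ρ : Measure f'.ker := Measure.addHaar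
  obtain ⟨b, hb, hbB'0, hbB', hbfin⟩ : ∃ b : Set f'.ker, IsOpen b ∧ (Ψ a).2 ∈ b ∧ b ⊆ B' ∧ ρ b ≠ ∞ := by
    obtain ⟨r, hr, hrB⟩ := Metric.isOpen_iff.1 hB' _ haB'
    exact ⟨Metric.ball _ r, Metric.isOpen_ball, Metric.mem_ball_self hr, hrB,
      measure_ball_lt_top.ne⟩
  let g := e.symm ∘ Ψ
  let W := Ψ.source ∩ Ψ ⁻¹' (B ×ˢ b)
  have hWNA : W ⊆ N ∩ A := fun x hx => by
    have := (hBB (prod_mono_right hbB' hx.2)).2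
    rwa [mem_preimage, Ψ.left_inv hx.1] at this
  let κ : ℝ≥0 := (μ.map e).addHaarScalarFactor (ν.prod ρ)
  have hκ : μ.map e = κ • ν.prod ρ := Measure.isAddLeftInvariant_eq_smul _ _
  have hκ0 : 0 < κ := Measure.addHaarScalarFactor_pos_of_isAddHaarMeasure _ _
  have hb0 : 0 < ρ b := hb.measure_pos ρ ⟨_, hbB'0⟩
  obtain ⟨c, hc⟩ : ∃ c : ℝ≥0, (c : ℝ≥0∞) = ρ b := ENNReal.canLift.prf _ hbfin
  have hc0 : c ≠ 0 := by rintro rfl; simp [← hc] at hb0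
  -- In the straightened coordinates the set is the box `(B ∩ T) ×ˢ b`; `κ` compares the two Haar
  -- measures and `c` is the fibre volume.
  have himage : ∀ T : Set F, μ (g '' (W ∩ f ⁻¹' T)) = (κ * c : ℝ≥0) * ν (B ∩ T) := fun T => by
    have h₁ : Ψ '' (W ∩ f ⁻¹' T) = (B ∩ T) ×ˢ b := by
      ext ⟨y, z⟩
      constructor
      · rintro ⟨x, ⟨⟨-, hx⟩, hxT⟩, hxy⟩
        rw [mem_preimage, hxy] at hx
        rw [mem_preimage, ← hΨf, hxy] at hxT
        exact ⟨⟨hx.1, hxT⟩, hx.2⟩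
      · rintro ⟨⟨hy, hyT⟩, hz⟩
        have ht : (y, z) ∈ Ψ.target := (hBB ⟨hy, hbB' hz⟩).1
        refine ⟨Ψ.symm (y, z), ⟨⟨Ψ.map_target ht, ?_⟩, ?_⟩, Ψ.right_inv ht⟩
        · rw [mem_preimage, Ψ.right_inv ht]; exact ⟨hy, hz⟩
        · rw [mem_preimage, ← hΨf, Ψ.right_inv ht]; exact hyT
    rw [image_comp, h₁, e.symm.image_eq_preimage_symm, e.symm_symm]
    have h₂ := e.toHomeomorph.toMeasurableEquiv.map_apply (μ := μ) ((B ∩ T) ×ˢ b)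
    change μ.map e _ = μ (e ⁻¹' _) at h₂
    rw [← h₂, hκ, Measure.smul_apply, Measure.prod_prod, ← hc, ENNReal.smul_def, smul_eq_mul,
      ENNReal.coe_mul]
    ring
  have happW : ∀ T : Set F, ApproximatesLinearOn g (ContinuousLinearMap.id ℝ E) (W ∩ f ⁻¹' T) δ :=
    fun T => happ.mono_set fun x hx => (hWNA hx.1).2
  have hK : (κ * c : ℝ≥0) ≠ 0 := mul_ne_zero hκ0.ne' hc0
  refine ⟨W, fun x hx => (hWNA hx).1, Ψ.isOpen_inter_preimage (hB.prod hb), ⟨ha, haB, hbB'0⟩,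
    B, hB, haB, 2 * (κ * c) + 2 * (κ * c)⁻¹, fun T => ⟨?_, fun hT => ?_⟩⟩
  · have h := hδ₂ _ g (happW T)
    rw [himage, ENNReal.coe_inv two_ne_zero, ENNReal.inv_mul_le_iff (by simp) (by simp)] at h
    refine h.trans ?_
    rw [← mul_assoc]
    gcongr
    · norm_cast
      exact le_self_add
    · exact inter_subset_right
  · have h := hδ₁ _ g (happW T)
    rw [himage, inter_eq_self_of_subset_right hT] at h
    calc ν T = ((κ * c)⁻¹ : ℝ≥0) * ((κ * c : ℝ≥0) * ν T) := by
          rw [← mul_assoc, ← ENNReal.coe_mul, inv_mul_cancel₀ hK, ENNReal.coe_one, one_mul]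
      _ ≤ ((κ * c)⁻¹ : ℝ≥0) * ((2 : ℝ≥0) * μ (W ∩ f ⁻¹' T)) := by gcongr
      _ ≤ _ := by
          rw [← mul_assoc, ← ENNReal.coe_mul, mul_comm _ (2 : ℝ≥0)]
          gcongr
          exact le_add_self

/-! ### Volume forms on frames of bounded distortion -/

/-- An alternating form of top degree picks up the determinant of a linear endomorphism. -/
theorem AlternatingMap.comp_linearMap_basis_apply {R M N ι : Type*} [CommRing R] [AddCommGroup M]
    [Module R M] [AddCommGroup N] [Module R N] [Fintype ι] [DecidableEq ι]
    (ω : N [⋀^ι]→ₗ[R] R) (L : M →ₗ[R] N) (A : M →ₗ[R] M) (e : Module.Basis ι R M) :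
    ω (fun i => L (A (e i))) = LinearMap.det A * ω (fun i => L (e i)) := by
  have h := congrArg (fun F : M [⋀^ι]→ₗ[R] R => F (A ∘ e))
    ((ω.compLinearMap L).eq_smul_basis_det e)
  simp only [AlternatingMap.smul_apply, Module.Basis.det_comp, e.det_self] at h
  have h' : ω (fun i => L (A (e i))) = ω (fun i => L (e i)) * (LinearMap.det A * 1) := h
  rw [h']; ring

namespace Orientation

variable {k : ℕ} {G : Type*} [NormedAddCommGroup G] [InnerProductSpace ℝ G]
  [Fact (Module.finrank ℝ G = k)] (o : Orientation ℝ G (Fin k))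

theorem abs_volumeForm_apply_le_pow {C : ℝ} {v : Fin k → G} (hv : ∀ i, ‖v i‖ ≤ C) :
    |o.volumeForm v| ≤ C ^ k :=
  (o.abs_volumeForm_apply_le v).trans <| by
    simpa using Finset.prod_le_prod (s := Finset.univ) (fun i _ => norm_nonneg (v i))
      fun i _ => hv i

/-- An orthonormal basis `b` has volume ±1 and equals `L ∘ A` of the standard basis, where `A` sends
that basis to `L.symm ∘ b`. Hadamard's inequality gives `|det A| ≤ C ^ k`. -/
theorem one_le_pow_mul_abs_volumeForm_apply {C : ℝ}
    (L : EuclideanSpace ℝ (Fin k) ≃ₗ[ℝ] G)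
    (hL : ∀ w, ‖L.symm w‖ ≤ C * ‖w‖) :
    1 ≤ C ^ k * |o.volumeForm fun i => L (EuclideanSpace.single i 1)| := by
  have := L.finiteDimensional
  let b : OrthonormalBasis (Fin k) ℝ G :=
    (stdOrthonormalBasis ℝ G).reindex (finCongr (Fact.out : Module.finrank ℝ G = k))
  let e := EuclideanSpace.basisFun (Fin k) ℝ
  let A : EuclideanSpace ℝ (Fin k) →ₗ[ℝ] EuclideanSpace ℝ (Fin k) :=
    e.toBasis.constr ℝ fun i => L.symm (b i)
  have hA : ∀ i, A (e i) = L.symm (b i) := fun i => by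
    rw [← e.coe_toBasis]; exact e.toBasis.constr_basis ℝ _ i
  have hdet : |LinearMap.det A| ≤ C ^ k := by
    have : Fact (Module.finrank ℝ (EuclideanSpace ℝ (Fin k)) = k) := ⟨finrank_euclideanSpace_fin⟩
    let oE := e.toBasis.orientation
    have h := AlternatingMap.comp_linearMap_basis_apply oE.volumeForm LinearMap.id A e.toBasis
    simp only [LinearMap.id_apply, OrthonormalBasis.coe_toBasis, hA] at h
    have h1 : |oE.volumeForm fun i => e i| = 1 := oE.abs_volumeForm_apply_of_orthonormal e
    rw [← mul_one |LinearMap.det A|, ← h1, ← abs_mul, ← h]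
    refine oE.abs_volumeForm_apply_le_pow fun i => (hL _).trans ?_
    simp
  have h := AlternatingMap.comp_linearMap_basis_apply o.volumeForm L.toLinearMap A e.toBasis
  simp only [OrthonormalBasis.coe_toBasis, hA, LinearEquiv.coe_coe, LinearEquiv.apply_symm_apply]
    at h
  have h1 := o.abs_volumeForm_apply_of_orthonormal b
  rw [h, abs_mul] at h1
  calc 1 = |LinearMap.det A| * |o.volumeForm fun i => L (e i)| := h1.symm
    _ ≤ C ^ k * |o.volumeForm fun i => L (e i)| := by gcongr
    _ = _ := by simp [e]

end Orientation

/-! ### Riemannian density in charts -/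

section RiemannianManifold

variable {k : ℕ} {M : Type*} [TopologicalSpace M]
  [ChartedSpace (EuclideanSpace ℝ (Fin k)) M] [IsManifold (𝓡 k) 1 M]

theorem differentiableAt_chart_comp_symm {x₀ : M}
    {φ : OpenPartialHomeomorph M (EuclideanSpace ℝ (Fin k))}
    (hφ : φ ∈ atlas (EuclideanSpace ℝ (Fin k)) M) {y : EuclideanSpace ℝ (Fin k)}
    (hy : y ∈ φ.target) (hx : φ.symm y ∈ (chartAt (EuclideanSpace ℝ (Fin k)) x₀).source) :
    DifferentiableAt ℝ (chartAt (EuclideanSpace ℝ (Fin k)) x₀ ∘ φ.symm) y := by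
  rw [← mdifferentiableAt_iff_differentiableAt]
  exact (mdifferentiableAt_atlas (I := 𝓡 k) (chart_mem_atlas _ x₀) hx).comp y
    (mdifferentiableAt_atlas_symm hφ hy)

/-- The coordinate frame of a chart, read in the trivialization of the tangent bundle given by
another chart, is given by the derivative of the change of coordinates. -/
theorem continuousLinearMapAt_trivializationAt_coordFrame {x₀ : M}
    {φ : OpenPartialHomeomorph M (EuclideanSpace ℝ (Fin k))}
    (hφ : φ ∈ atlas (EuclideanSpace ℝ (Fin k)) M) {y : EuclideanSpace ℝ (Fin k)}
    (hy : y ∈ φ.target) (hx : φ.symm y ∈ (chartAt (EuclideanSpace ℝ (Fin k)) x₀).source)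
    (i : Fin k) :
    (trivializationAt (EuclideanSpace ℝ (Fin k)) (TangentSpace (𝓡 k)) x₀).continuousLinearMapAt ℝ
      (φ.symm y) (coordFrame φ y i) =
    fderiv ℝ (chartAt (EuclideanSpace ℝ (Fin k)) x₀ ∘ φ.symm) y (EuclideanSpace.single i 1) := by
  rw [TangentBundle.continuousLinearMapAt_trivializationAt hx, ← mfderiv_eq_fderiv]
  have h := mfderiv_comp (I := 𝓡 k) (I' := 𝓡 k) (I'' := 𝓡 k) y
    (mdifferentiableAt_atlas (I := 𝓡 k) (chart_mem_atlas _ x₀) hx)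
    (mdifferentiableAt_atlas_symm hφ hy)
  rw [h]
  rfl

variable [RiemannianBundle (fun x : M => TangentSpace (𝓡 k) x)]
  [IsContinuousRiemannianBundle (EuclideanSpace ℝ (Fin k)) (fun x : M => TangentSpace (𝓡 k) x)]

/-- Near a point, the density of the Riemannian volume in any chart is bounded by a multiple of the
Jacobian of the change of coordinates, and it is bounded below in the preferred chart. -/
theorem exists_nhds_riemannianVolumeForm_coordFrame_bounds (o : ManifoldOrientation k M) (x₀ : M) :
    ∃ C : ℝ≥0, ∃ U ∈ 𝓝 x₀, U ⊆ (chartAt (EuclideanSpace ℝ (Fin k)) x₀).source ∧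
      (∀ φ ∈ atlas (EuclideanSpace ℝ (Fin k)) M, ∀ y ∈ φ.target, φ.symm y ∈ U →
        |riemannianVolumeForm o (φ.symm y) (coordFrame φ y)| ≤
          C * |(fderiv ℝ (chartAt (EuclideanSpace ℝ (Fin k)) x₀ ∘ φ.symm) y).det|) ∧
      ∀ y ∈ (chartAt (EuclideanSpace ℝ (Fin k)) x₀).target,
        (chartAt (EuclideanSpace ℝ (Fin k)) x₀).symm y ∈ U →
        1 ≤ C * |riemannianVolumeForm o ((chartAt (EuclideanSpace ℝ (Fin k)) x₀).symm y)
          (coordFrame (chartAt (EuclideanSpace ℝ (Fin k)) x₀) y)| := by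
  obtain ⟨C₁, hC₁, h₁⟩ := eventually_norm_trivializationAt_lt (EuclideanSpace ℝ (Fin k))
    (fun x : M => TangentSpace (𝓡 k) x) x₀
  obtain ⟨C₂, hC₂, h₂⟩ := eventually_norm_symmL_trivializationAt_lt (EuclideanSpace ℝ (Fin k))
    (fun x : M => TangentSpace (𝓡 k) x) x₀
  -- Continuity of the metric bounds the trivialization and its inverse near `x₀`; `C` bounds both
  -- operator norms.
  let C := max C₁ C₂
  have hC : 0 < C := lt_max_of_lt_left hC₁
  let T := trivializationAt (EuclideanSpace ℝ (Fin k)) (fun x : M => TangentSpace (𝓡 k) x) x₀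
  let ψ := chartAt (EuclideanSpace ℝ (Fin k)) x₀
  have hframe : ∀ φ ∈ atlas (EuclideanSpace ℝ (Fin k)) M, ∀ y ∈ φ.target,
      ∀ hx : φ.symm y ∈ ψ.source, coordFrame φ y = fun i =>
        (T.continuousLinearEquivAt ℝ (φ.symm y) hx).symm
          (fderiv ℝ (ψ ∘ φ.symm) y (EuclideanSpace.basisFun (Fin k) ℝ i)) := by
    intro φ hφ y hy hx
    ext1 i
    rw [ContinuousLinearEquiv.eq_symm_apply, EuclideanSpace.basisFun_apply]
    refine Eq.trans ?_ (continuousLinearMapAt_trivializationAt_coordFrame hφ hy hx i)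
    exact congrFun (T.coe_continuousLinearEquivAt_eq (R := ℝ) hx) _
  refine ⟨⟨C ^ k, by positivity⟩, _, inter_mem (inter_mem h₁ h₂)
    (ψ.open_source.mem_nhds (mem_chart_source _ x₀)), fun x hx => hx.2, ?_, ?_⟩
  · rintro φ hφ y hy ⟨⟨hx₁, hx₂⟩, hx⟩
    rw [hframe φ hφ y hy hx]
    have h := AlternatingMap.comp_linearMap_basis_apply (riemannianVolumeForm o (φ.symm y))
      (T.continuousLinearEquivAt ℝ (φ.symm y) hx).symm.toLinearEquiv.toLinearMap
      (fderiv ℝ (ψ ∘ φ.symm) y).toLinearMap (EuclideanSpace.basisFun (Fin k) ℝ).toBasis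
    simp only [OrthonormalBasis.coe_toBasis] at h
    change |riemannianVolumeForm o (φ.symm y) fun i =>
      (T.continuousLinearEquivAt ℝ (φ.symm y) hx).symm.toLinearEquiv.toLinearMap
      ((fderiv ℝ (ψ ∘ φ.symm) y).toLinearMap (EuclideanSpace.basisFun (Fin k) ℝ i))| ≤ _
    rw [h, abs_mul, mul_comm]
    gcongr
    · refine (o.orientationAt (φ.symm y)).abs_volumeForm_apply_le_pow fun i => ?_
      change ‖(T.continuousLinearEquivAt ℝ (φ.symm y) hx).symm _‖ ≤ C
      rw [T.symm_continuousLinearEquivAt_eq (R := ℝ) hx]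
      refine (ContinuousLinearMap.le_of_opNorm_le _ (hx₂.le.trans (le_max_right C₁ C₂)) _).trans ?_
      simp [C]
  · rintro y hy ⟨⟨hx₁, hx₂⟩, hx⟩
    rw [hframe ψ (chart_mem_atlas _ x₀) y hy hx]
    have h := (o.orientationAt (ψ.symm y)).one_le_pow_mul_abs_volumeForm_apply (C := C)
      (T.continuousLinearEquivAt ℝ (ψ.symm y) hx).symm.toLinearEquiv fun w => by
        change ‖(T.continuousLinearEquivAt ℝ (ψ.symm y) hx) w‖ ≤ _
        rw [T.coe_continuousLinearEquivAt_eq (R := ℝ) hx]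
        exact ContinuousLinearMap.le_of_opNorm_le _ (hx₁.le.trans (le_max_left C₁ C₂)) _
    have hid : fderiv ℝ (ψ ∘ ψ.symm) y = ContinuousLinearMap.id ℝ _ := by
      rw [← fderiv_id (𝕜 := ℝ) (x := y)]
      exact (Filter.eventuallyEq_of_mem (ψ.open_target.mem_nhds hy)
        fun z hz => ψ.right_inv hz).fderiv_eq
    rw [hid]
    simp only [EuclideanSpace.basisFun_apply, ContinuousLinearMap.id_apply]
    exact h

end RiemannianManifold

theorem OpenPartialHomeomorph.measurableSet_target_inter_preimage_symm {X Y : Type*}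
    [TopologicalSpace X] [MeasurableSpace X] [BorelSpace X]
    [TopologicalSpace Y] [MeasurableSpace Y] [BorelSpace Y]
    (φ : OpenPartialHomeomorph X Y) {A : Set X} (hA : MeasurableSet A) :
    MeasurableSet (φ.target ∩ φ.symm ⁻¹' A) := by
  have h := φ.open_target.measurableSet.subtype_image
    ((continuousOn_iff_continuous_domRestrict.1 φ.continuousOn_symm).measurable hA)
  rwa [domRestrict_eq, preimage_comp, Subtype.image_preimage_coe] at h

/-! ### Riemannian volume against Lebesgue measure -/

section RiemannianMeasure

variable {k : ℕ} {M : Type*} [TopologicalSpace M]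
  [ChartedSpace (EuclideanSpace ℝ (Fin k)) M] [IsManifold (𝓡 k) 1 M]
  [RiemannianBundle (fun x : M => TangentSpace (𝓡 k) x)]
  [MeasurableSpace M] [BorelSpace M]

theorem chartRiemannianVolume_apply (o : ManifoldOrientation k M)
    (φ : OpenPartialHomeomorph M (EuclideanSpace ℝ (Fin k))) {A : Set M} (hA : MeasurableSet A) :
    chartRiemannianVolume o φ A = ∫⁻ y in φ.target ∩ φ.symm ⁻¹' A,
      ‖riemannianVolumeForm o (φ.symm y) (coordFrame φ y)‖ₑ := by
  have h : AEMeasurable φ.symm (volume.restrict φ.target) :=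
    φ.continuousOn_symm.aemeasurable φ.open_target.measurableSet
  rw [chartRiemannianVolume, Measure.map_apply_of_aemeasurable
    (h.mono_ac (withDensity_absolutelyContinuous _ _)) hA, withDensity_apply',
    Measure.restrict_restrict' φ.open_target.measurableSet, inter_comm]

variable [IsContinuousRiemannianBundle (EuclideanSpace ℝ (Fin k))
  (fun x : M => TangentSpace (𝓡 k) x)]

/-- Near a point, the volumes of all charts are bounded by Lebesgue measure in the preferred chart,
and they are bounded below by it for the preferred chart. -/
theorem exists_nhds_chartRiemannianVolume_bounds (o : ManifoldOrientation k M) (x₀ : M) :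
    ∃ C : ℝ≥0, ∃ U ∈ 𝓝 x₀, U ⊆ (chartAt (EuclideanSpace ℝ (Fin k)) x₀).source ∧
      ∀ A ⊆ U, MeasurableSet A →
        (∀ φ ∈ atlas (EuclideanSpace ℝ (Fin k)) M, chartRiemannianVolume o φ A ≤
          C * volume (chartAt (EuclideanSpace ℝ (Fin k)) x₀ '' A)) ∧
        volume (chartAt (EuclideanSpace ℝ (Fin k)) x₀ '' A) ≤
          C * chartRiemannianVolume o (chartAt (EuclideanSpace ℝ (Fin k)) x₀) A := by
  obtain ⟨C, U, hU, hUs, h₁, h₂⟩ := exists_nhds_riemannianVolumeForm_coordFrame_bounds o x₀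
  let ψ := chartAt (EuclideanSpace ℝ (Fin k)) x₀
  refine ⟨C, U, hU, hUs, fun A hAU hA => ⟨fun φ hφ => ?_, ?_⟩⟩
  · have hS := φ.measurableSet_target_inter_preimage_symm hA
    let S := φ.target ∩ φ.symm ⁻¹' A
    have hinj : InjOn (ψ ∘ φ.symm) S := ψ.injOn.comp (φ.symm.injOn.mono inter_subset_left)
      fun y hy => hUs (hAU hy.2)
    have himage : (ψ ∘ φ.symm) '' S ⊆ ψ '' A := by
      rw [image_comp]
      exact image_mono (image_subset_iff.2 inter_subset_right)
    calc chartRiemannianVolume o φ A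
        = ∫⁻ y in S, ‖riemannianVolumeForm o (φ.symm y) (coordFrame φ y)‖ₑ :=
          chartRiemannianVolume_apply o φ hA
      _ ≤ ∫⁻ y in S, C * ENNReal.ofReal |(fderiv ℝ (ψ ∘ φ.symm) y).det| := by
          refine setLIntegral_mono' hS fun y hy => ?_
          rw [← ENNReal.ofReal_coe_nnreal, ← ENNReal.ofReal_mul C.coe_nonneg, Real.enorm_eq_ofReal_abs]
          exact ENNReal.ofReal_le_ofReal (h₁ φ hφ y hy.1 (hAU hy.2))
      -- Change of variables for the injective transition map.
      _ = C * volume ((ψ ∘ φ.symm) '' S) := by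
          rw [lintegral_const_mul' _ _ ENNReal.coe_ne_top,
            lintegral_abs_det_fderiv_eq_addHaar_image volume hS (fun y hy =>
              (differentiableAt_chart_comp_symm hφ hy.1
                (hUs (hAU hy.2))).hasFDerivAt.hasFDerivWithinAt) hinj]
      _ ≤ _ := by gcongr
  · have hS := ψ.measurableSet_target_inter_preimage_symm hA
    have himage : ψ '' A = ψ.target ∩ ψ.symm ⁻¹' A :=
      ψ.image_eq_target_inter_inv_preimage (hAU.trans hUs)
    change volume (ψ '' A) ≤ C * chartRiemannianVolume o ψ A
    rw [himage, chartRiemannianVolume_apply o ψ hA, ← lintegral_const_mul' _ _ ENNReal.coe_ne_top,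
      ← setLIntegral_one]
    refine setLIntegral_mono' hS fun y hy => ?_
    rw [← ENNReal.ofReal_coe_nnreal, Real.enorm_eq_ofReal_abs, ← ENNReal.ofReal_mul C.coe_nonneg,
      ← ENNReal.ofReal_one]
    exact ENNReal.ofReal_le_ofReal (h₂ y hy.1 (hAU hy.2))

/-- Near a point, the Riemannian volume is comparable with Lebesgue measure in a chart. -/
theorem exists_nhds_riemannianVolume_bounds (o : ManifoldOrientation k M) (x₀ : M) :
    ∃ C : ℝ≥0, ∃ U : Set M, IsOpen U ∧ x₀ ∈ U ∧
      U ⊆ (chartAt (EuclideanSpace ℝ (Fin k)) x₀).source ∧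
      ∀ A ⊆ U, MeasurableSet A →
        riemannianVolume o A ≤ C * volume (chartAt (EuclideanSpace ℝ (Fin k)) x₀ '' A) ∧
        volume (chartAt (EuclideanSpace ℝ (Fin k)) x₀ '' A) ≤ C * riemannianVolume o A := by
  obtain ⟨C, U', hU', hUs', h⟩ := exists_nhds_chartRiemannianVolume_bounds o x₀
  obtain ⟨U, hUU, hU, hxU⟩ := mem_nhds_iff.1 hU'
  let ψ := chartAt (EuclideanSpace ℝ (Fin k)) x₀
  have hψ : AEMeasurable ψ.symm (volume.restrict ψ.target) :=
    ψ.continuousOn_symm.aemeasurable ψ.open_target.measurableSet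
  let ν : Measure M := (volume.restrict ψ.target).map ψ.symm
  have hν : ∀ A ⊆ U, MeasurableSet A → ν A = volume (ψ '' A) := fun A hAU hA => by
    rw [ψ.image_eq_target_inter_inv_preimage ((hAU.trans hUU).trans hUs'),
      Measure.map_apply_of_aemeasurable hψ hA,
      Measure.restrict_apply' ψ.open_target.measurableSet, inter_comm]
  refine ⟨C, U, hU, hxU, hUU.trans hUs', fun A hAU hA => ⟨?_, ?_⟩⟩
  -- A supremum of measures is not computed setwise, so the bound on subsets of `U` is made a bound
  -- between measures by adding one that is infinite on every measurable set meeting `Uᶜ`. For the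
  -- other inequality a single chart suffices.
  · have hle : riemannianVolume o ≤ C • ν + (⊤ : Measure M).restrict Uᶜ := by
      refine iSup₂_le fun φ hφ => Measure.le_iff.2 fun B hB => ?_
      by_cases hBU : B ⊆ U
      · rw [Measure.add_apply, Measure.smul_apply, hν B hBU hB]
        exact ((h B (hBU.trans hUU) hB).1 φ hφ).trans le_self_add
      · have hne : (B ∩ Uᶜ).Nonempty := not_subset.1 hBU
        rw [Measure.add_apply, Measure.restrict_apply hB, ← Measure.toOuterMeasure_apply ⊤,
          Measure.toOuterMeasure_top, OuterMeasure.top_apply hne, add_top]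
        exact le_top
    refine (hle A).trans ?_
    rw [Measure.add_apply, Measure.smul_apply, hν A hAU hA, Measure.restrict_apply hA,
      (disjoint_compl_right_iff_subset.2 hAU).inter_eq]
    simp [ENNReal.smul_def, ψ]
  · refine (h A (hAU.trans hUU) hA).2.trans ?_
    gcongr
    exact le_iSup₂ (f := fun φ (_ : φ ∈ atlas (EuclideanSpace ℝ (Fin k)) M) =>
      chartRiemannianVolume o φ) _ (chart_mem_atlas _ x₀)

/-- Near a regular point, a map from a Riemannian manifold transports the Riemannian volume to
Lebesgue measure up to multiplicative constants. -/
theorem IsRegularPoint.exists_open_riemannianVolume_preimage_le (o : ManifoldOrientation k M)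
    {ℓ : ℕ} {h : M → EuclideanSpace ℝ (Fin ℓ)} (hh : Continuous h) {z : M}
    (hz : IsRegularPoint (𝓡 k) (𝓡 ℓ) h z) :
    ∃ W : Set M, IsOpen W ∧ z ∈ W ∧ ∃ V, IsOpen V ∧ h z ∈ V ∧ ∃ C : ℝ≥0,
      ∀ T : Set (EuclideanSpace ℝ (Fin ℓ)), MeasurableSet T →
        riemannianVolume o (W ∩ h ⁻¹' T) ≤ C * volume T ∧
        (T ⊆ V → volume T ≤ C * riemannianVolume o (W ∩ h ⁻¹' T)) := by
  obtain ⟨C₁, U, hU, hzU, hUs, hC₁⟩ := exists_nhds_riemannianVolume_bounds o z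
  let ψ := chartAt (EuclideanSpace ℝ (Fin k)) z
  have hzψ : z ∈ ψ.source := mem_chart_source _ z
  have hcd : ContDiffAt ℝ 1 (h ∘ ψ.symm) (ψ z) := by
    have := (contMDiffAt_iff.1 hz.1).2
    simpa using! this
  have hmf : (mfderiv (𝓡 k) (𝓡 ℓ) h z : _) = fderiv ℝ (h ∘ ψ.symm) (ψ z) := by
    have := (hz.1.mdifferentiableAt one_ne_zero).mfderiv
    simpa using! this
  have hsurj : Function.Surjective (fderiv ℝ (h ∘ ψ.symm) (ψ z)) := by
    rw [← hmf]; exact hz.2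
  have hN : ψ.target ∩ ψ.symm ⁻¹' U ∈ 𝓝 (ψ z) :=
    inter_mem (ψ.open_target.mem_nhds (ψ.map_source hzψ))
      ((ψ.tendsto_symm hzψ) (hU.mem_nhds hzU))
  obtain ⟨W, hWN, hW, hzW, V, hV, hzV, C₂, hC₂⟩ :=
    (hcd.hasStrictFDerivAt one_ne_zero).exists_open_addHaar_preimage_le volume volume hsurj hN
  have hWU : ψ.source ∩ ψ ⁻¹' W ⊆ U := fun x hx => by
    have := (hWN hx.2).2
    rwa [mem_preimage, ψ.left_inv hx.1] at this
  refine ⟨ψ.source ∩ ψ ⁻¹' W, ψ.isOpen_inter_preimage hW, ⟨hzψ, hzW⟩, V, hV,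
    by simpa [ψ.left_inv hzψ] using hzV, C₁ * C₂, fun T hT => ?_⟩
  have hmeas : MeasurableSet (ψ.source ∩ ψ ⁻¹' W ∩ h ⁻¹' T) :=
    (ψ.isOpen_inter_preimage hW).measurableSet.inter (hh.measurable hT)
  have himage : ψ '' (ψ.source ∩ ψ ⁻¹' W ∩ h ⁻¹' T) = W ∩ (h ∘ ψ.symm) ⁻¹' T := by
    rw [ψ.image_eq_target_inter_inv_preimage (fun x hx => hx.1.1)]
    ext y
    constructor
    · rintro ⟨hy, hy'⟩
      exact ⟨by simpa [ψ.right_inv hy] using hy'.1.2, hy'.2⟩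
    · rintro ⟨hy, hyT⟩
      have ht := (hWN hy).1
      exact ⟨ht, ⟨ψ.map_target ht, by simpa [ψ.right_inv ht] using hy⟩, hyT⟩
  obtain ⟨h₁, h₂⟩ := hC₁ _ (inter_subset_left.trans hWU) hmeas
  change riemannianVolume o _ ≤ C₁ * volume (ψ '' _) at h₁
  change volume (ψ '' _) ≤ _ at h₂
  rw [himage] at h₁ h₂
  rw [ENNReal.coe_mul]
  constructor
  · rw [mul_assoc]
    exact h₁.trans (by gcongr; exact (hC₂ T).1)
  · intro hTV
    rw [mul_comm (C₁ : ℝ≥0∞), mul_assoc]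
    exact ((hC₂ T).2 hTV).trans (by gcongr)

end RiemannianMeasure

/-! ### Globalization by compactness -/

theorem mainTheorem5 {k : ℕ} {M : Type*} [TopologicalSpace M] [T2Space M]
    [SecondCountableTopology M] [CompactSpace M]
    [ChartedSpace (EuclideanSpace ℝ (Fin k)) M] [IsManifold (𝓡 k) 1 M]
    [RiemannianBundle (fun x : M => TangentSpace (𝓡 k) x)]
    [IsContinuousRiemannianBundle (EuclideanSpace ℝ (Fin k)) (fun x : M => TangentSpace (𝓡 k) x)]
    [MeasurableSpace M] [BorelSpace M] (o : ManifoldOrientation k M)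
    {ℓ : ℕ} (h : M → EuclideanSpace ℝ (Fin ℓ)) (hh : ContMDiff (𝓡 k) (𝓡 ℓ) 1 h)
    (hne : (h ⁻¹' {0}).Nonempty)
    (hreg : ∀ z ∈ h ⁻¹' {0}, IsRegularPoint (𝓡 k) (𝓡 ℓ) h z) :
    ∃ V : Set (EuclideanSpace ℝ (Fin ℓ)), IsOpen V ∧ 0 ∈ V ∧
      ∃ C : ℝ≥0, 0 < C ∧ ∀ E : Set (EuclideanSpace ℝ (Fin ℓ)), MeasurableSet E → E ⊆ V →
        riemannianVolume o (h ⁻¹' E) ≤ C * volume E ∧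
        volume E ≤ C * riemannianVolume o (h ⁻¹' E) := by
  choose! W hW hzW V hV hzV C hC using fun z hz =>
    (hreg z hz).exists_open_riemannianVolume_preimage_le o hh.continuous
  have hcompact : IsCompact (h ⁻¹' {0}) := (isClosed_singleton.preimage hh.continuous).isCompact
  obtain ⟨t, ht, hcover⟩ := hcompact.elim_nhds_subcover W fun z hz => (hW z hz).mem_nhds (hzW z hz)
  obtain ⟨z₀, hz₀⟩ := hne
  have hopen : IsOpen (⋃ z ∈ t, W z) := isOpen_biUnion fun z hz => hW z (ht z hz)
  have hclosed : IsClosed (h '' (⋃ z ∈ t, W z)ᶜ) :=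
    (hopen.isClosed_compl.isCompact.image hh.continuous).isClosed
  -- The second factor forces `h ⁻¹' E` into the cover, and `V z₀` serves the lower bound. The
  -- summand 1 makes the constant positive.
  refine ⟨V z₀ ∩ (h '' (⋃ z ∈ t, W z)ᶜ)ᶜ, (hV z₀ hz₀).inter hclosed.isOpen_compl, ⟨?_, ?_⟩,
    ∑ z ∈ t, C z + C z₀ + 1, by positivity, fun E hE hEV => ⟨?_, ?_⟩⟩
  · have := hzV z₀ hz₀
    rwa [show h z₀ = 0 from hz₀] at this
  · rintro ⟨x, hx, hx0⟩
    exact hx (hcover hx0)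
  · have hsub : h ⁻¹' E ⊆ ⋃ z ∈ t, W z ∩ h ⁻¹' E := fun x hx => by
      have hxW : x ∈ ⋃ z ∈ t, W z := by
        by_contra hxn
        exact (hEV hx).2 ⟨x, hxn, rfl⟩
      rw [← iUnion₂_inter]
      exact ⟨hxW, hx⟩
    calc riemannianVolume o (h ⁻¹' E) ≤ ∑ z ∈ t, riemannianVolume o (W z ∩ h ⁻¹' E) :=
          (measure_mono hsub).trans (measure_biUnion_finset_le t _)
      _ ≤ ∑ z ∈ t, C z * volume E := Finset.sum_le_sum fun z hz => (hC z (ht z hz) E hE).1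
      _ = (∑ z ∈ t, C z : ℝ≥0) * volume E := by rw [← Finset.sum_mul]; push_cast; rfl
      _ ≤ _ := by
          gcongr
          exact le_self_add.trans le_self_add
  · refine ((hC z₀ hz₀ E hE).2 (hEV.trans inter_subset_left)).trans ?_
    gcongr
    · exact le_add_self.trans le_self_add
    · exact inter_subset_right
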